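/- For $\alpha,\beta,F\in\mathbb{C}$ let $\mathcal{L}$ be the extended Heisenberg–Virasoro algebra: the complex Lie algebra with basis $L_m, J_m, G_m$ ($m\in\mathbb{Z}$), $C_1,C_2,C_3$, where $C_1,C_2,C_3$ are central and, for all $m,n\in\mathbb{Z}$, \begin{align*} &[L_m,L_n]=(m-n)L_{m+n}+\tfrac{m^3-m}{12}\,\delta_{m+n,0}C_1, && [G_m,G_n]=0,\\ &[L_m,J_n]=-nJ_{m+n}-(m^2+m)\,\delta_{m+n,0}C_2, && [J_m,J_n]=m\,\delta_{m+n,0}C_3,\\ &[L_m,G_n]=-(\alpha+n+m\beta)G_{m+n}, && [J_m,G_n]=F\,G_{m+n}. \end{align*} For an integer $d\ge 0$ let $\mathcal{L}_d$ be the subalgebra spanned by $L_i$, $J_i$, $G_{-d+i}$ ($i\ge 0$) and $C_1,C_2,C_3$. Suppose that $F\neq 0$, let $d\ge 0$ be an integer, and let $V$ be a simple $\mathcal{L}_d$-module. Assume that there are integers $k,l\ge 0$ with $l>k+d>0$ such that (a) $G_k$ and $L_l$ act injectively on $V$, and (b) $G_{k+i}V=J_{k+d+i}V=L_{l+i}V=0$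 for all integers $i\ge 1$. Then the induced module $\mathrm{Ind}_{\mathcal{L}_d}^{\mathcal{L}}(V)=U(\mathcal{L})\otimes_{U(\mathcal{L}_d)}V$ is a simple $\mathcal{L}$-module. -/

import Mathlib

open scoped TensorProduct

noncomputable section

/-! ### Induced modules -/

namespace LieInduction

attribute [local instance 100] LieRing.ofAssociativeRing

variable (R : Type*) [CommRing R] {𝔤 : Type*} [LieRing 𝔤] [LieAlgebra R 𝔤]
  (𝔥 : LieSubalgebra R 𝔤)
  (V : Type*) [AddCommGroup V] [Module R V] [LieRingModule 𝔥 V] [LieModule R 𝔥 V]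

/-- The homomorphism `U(𝔥) → U(𝔤)` given by the inclusion of the subalgebra `𝔥` in `𝔤`. -/
def envIncl : UniversalEnvelopingAlgebra R 𝔥 →ₐ[R] UniversalEnvelopingAlgebra R 𝔤 :=
  UniversalEnvelopingAlgebra.lift R ((UniversalEnvelopingAlgebra.ι R).comp 𝔥.incl)

/-- The action of `U(𝔥)` on the `𝔥`-module `V`. -/
def envAction : UniversalEnvelopingAlgebra R 𝔥 →ₐ[R] Module.End R V :=
  UniversalEnvelopingAlgebra.lift R (LieModule.toEnd R 𝔥 V)

/-- The `U(𝔤)`-submodule of `U(𝔤) ⊗[R] V` generated by the elements `u w ⊗ v - u ⊗ w v`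
with `u ∈ U(𝔤)`, `w ∈ U(𝔥)`, `v ∈ V`. -/
def relations : Submodule (UniversalEnvelopingAlgebra R 𝔤)
    (UniversalEnvelopingAlgebra R 𝔤 ⊗[R] V) :=
  Submodule.span _ {t | ∃ (u : UniversalEnvelopingAlgebra R 𝔤)
    (w : UniversalEnvelopingAlgebra R 𝔥) (v : V),
    t = (u * envIncl R 𝔥 w) ⊗ₜ[R] v - u ⊗ₜ[R] (envAction R 𝔥 V w v)}

/-- The induced module `U(𝔤) ⊗_{U(𝔥)} V` (Mathlib's tensor product is over commutative rings
only, so the tensor product over `U(𝔥)` is written as a quotient of the one over `R`). -/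
def Ind : Type _ := (UniversalEnvelopingAlgebra R 𝔤 ⊗[R] V) ⧸ relations R 𝔥 V

instance : AddCommGroup (Ind R 𝔥 V) :=
  inferInstanceAs (AddCommGroup ((UniversalEnvelopingAlgebra R 𝔤 ⊗[R] V) ⧸ relations R 𝔥 V))

instance : Module (UniversalEnvelopingAlgebra R 𝔤) (Ind R 𝔥 V) :=
  inferInstanceAs (Module (UniversalEnvelopingAlgebra R 𝔤)
    ((UniversalEnvelopingAlgebra R 𝔤 ⊗[R] V) ⧸ relations R 𝔥 V))

instance : Module R (Ind R 𝔥 V) :=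
  inferInstanceAs (Module R ((UniversalEnvelopingAlgebra R 𝔤 ⊗[R] V) ⧸ relations R 𝔥 V))

instance : IsScalarTower R (UniversalEnvelopingAlgebra R 𝔤) (Ind R 𝔥 V) :=
  inferInstanceAs (IsScalarTower R (UniversalEnvelopingAlgebra R 𝔤)
    ((UniversalEnvelopingAlgebra R 𝔤 ⊗[R] V) ⧸ relations R 𝔥 V))

/-- `𝔤` acts on the induced module through `𝔤 → U(𝔤)`, by left multiplication. -/
instance : LieRingModule 𝔤 (Ind R 𝔥 V) where
  bracket x m := UniversalEnvelopingAlgebra.ι R x • m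
  add_lie x y m := by
    change UniversalEnvelopingAlgebra.ι R (x + y) • m = _
    rw [map_add, add_smul]
  lie_add x m n := smul_add (UniversalEnvelopingAlgebra.ι R x) m n
  leibniz_lie x y m := by
    change UniversalEnvelopingAlgebra.ι R x • UniversalEnvelopingAlgebra.ι R y • m =
      UniversalEnvelopingAlgebra.ι R ⁅x, y⁆ • m +
        UniversalEnvelopingAlgebra.ι R y • UniversalEnvelopingAlgebra.ι R x • m
    rw [LieHom.map_lie, LieRing.of_associative_ring_bracket, sub_smul, mul_smul, mul_smul,
      sub_add_cancel]

instance : LieModule R 𝔤 (Ind R 𝔥 V) where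
  smul_lie t x m := by
    change UniversalEnvelopingAlgebra.ι R (t • x) • m = t • (UniversalEnvelopingAlgebra.ι R x • m)
    rw [map_smul, smul_assoc]
  lie_smul t x m := by
    change UniversalEnvelopingAlgebra.ι R x • (t • m) = t • (UniversalEnvelopingAlgebra.ι R x • m)
    rw [← algebraMap_smul (UniversalEnvelopingAlgebra R 𝔤) t m,
      ← algebraMap_smul (UniversalEnvelopingAlgebra R 𝔤) t (_ • m), smul_smul, smul_smul,
      Algebra.commutes]

end LieInduction

/-! ### The extended Heisenberg-Virasoro algebra -/

namespace ExtHV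

/-- Labels of the basis `L_m, J_m, G_m` (`m ∈ ℤ`), `C_1, C_2, C_3`. -/
inductive Gen : Type
  | L (m : ℤ)
  | J (m : ℤ)
  | G (m : ℤ)
  | C₁
  | C₂
  | C₃

end ExtHV

/-- The extended Heisenberg-Virasoro algebra with parameters `α, β, F`: the complex vector space
with basis `L_m, J_m, G_m` (`m ∈ ℤ`), `C_1, C_2, C_3`. -/
@[nolint unusedArguments]
def ExtHV (_α _β _F : ℂ) : Type := ExtHV.Gen →₀ ℂ

namespace ExtHV

variable (α β F : ℂ)

instance : AddCommGroup (ExtHV α β F) := inferInstanceAs (AddCommGroup (Gen →₀ ℂ))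

instance : Module ℂ (ExtHV α β F) := inferInstanceAs (Module ℂ (Gen →₀ ℂ))

/-- The basis of the algebra. -/
def basis : Module.Basis Gen ℂ (ExtHV α β F) := Finsupp.basisSingleOne

/-- The basis vector `L_m`. -/
def L (m : ℤ) : ExtHV α β F := basis α β F (.L m)
/-- The basis vector `J_m`. -/
def J (m : ℤ) : ExtHV α β F := basis α β F (.J m)
/-- The basis vector `G_m`. -/
def G (m : ℤ) : ExtHV α β F := basis α β F (.G m)
/-- The central basis vector `C_1`. -/
def C₁ : ExtHV α β F := basis α β F .C₁
/-- The central basis vector `C_2`. -/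
def C₂ : ExtHV α β F := basis α β F .C₂
/-- The central basis vector `C_3`. -/
def C₃ : ExtHV α β F := basis α β F .C₃

/-- The brackets of the basis vectors. -/
def genBracket : Gen → Gen → ExtHV α β F
  | .L m, .L n => ((m : ℂ) - n) • L α β F (m + n) +
      (if m + n = 0 then ((m : ℂ) ^ 3 - m) / 12 else 0) • C₁ α β F
  | .L m, .J n => (-(n : ℂ)) • J α β F (m + n) -
      (if m + n = 0 then (m : ℂ) ^ 2 + m else 0) • C₂ α β F
  | .J n, .L m => (n : ℂ) • J α β F (m + n) +
      (if m + n = 0 then (m : ℂ) ^ 2 + m else 0) • C₂ α β F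
  | .J m, .J n => (if m + n = 0 then (m : ℂ) else 0) • C₃ α β F
  | .L m, .G n => (-(α + n + m * β)) • G α β F (m + n)
  | .G n, .L m => (α + n + m * β) • G α β F (m + n)
  | .J m, .G n => F • G α β F (m + n)
  | .G n, .J m => (-F) • G α β F (m + n)
  | _, _ => 0

/-- The bilinear extension of `genBracket`. -/
def bracketₗ : ExtHV α β F →ₗ[ℂ] ExtHV α β F →ₗ[ℂ] ExtHV α β F :=
  (basis α β F).constr ℂ fun a => (basis α β F).constr ℂ fun b => genBracket α β F a b

theorem bracketₗ_basis (a b : Gen) :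
    bracketₗ α β F (basis α β F a) (basis α β F b) = genBracket α β F a b := by
  simp [bracketₗ, Module.Basis.constr_basis]

theorem bracketₗ_swap (x y : ExtHV α β F) : bracketₗ α β F x y = -bracketₗ α β F y x := by
  have h : bracketₗ α β F = -(bracketₗ α β F).flip := by
    refine (basis α β F).ext fun a => (basis α β F).ext fun b => ?_
    simp only [LinearMap.neg_apply, LinearMap.flip_apply, bracketₗ_basis]
    cases a <;> cases b <;> simp only [genBracket, neg_zero]
    case L.L m n =>
      rw [add_comm n m]
      split_ifs with h
      · obtain rfl : n = -m := by omega
        push_cast; module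
      · module
    case J.J m n =>
      rw [add_comm n m]
      split_ifs with h
      · obtain rfl : n = -m := by omega
        push_cast; module
      · module
    all_goals module
  exact congrArg (fun f => f x y) h

theorem jacobi_basis (a b c : Gen) :
    bracketₗ α β F (basis α β F a) (bracketₗ α β F (basis α β F b) (basis α β F c)) =
      bracketₗ α β F (bracketₗ α β F (basis α β F a) (basis α β F b)) (basis α β F c) +
        bracketₗ α β F (basis α β F b) (bracketₗ α β F (basis α β F a) (basis α β F c)) := by
  have hl (z : Gen) (hz : ∀ b, genBracket α β F z b = 0) :
      bracketₗ α β F (basis α β F z) = 0 :=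
    (basis α β F).ext fun b => by rw [bracketₗ_basis, hz, LinearMap.zero_apply]
  have hl₁ := hl .C₁ fun b => by cases b <;> rfl
  have hl₂ := hl .C₂ fun b => by cases b <;> rfl
  have hl₃ := hl .C₃ fun b => by cases b <;> rfl
  have hr (z : Gen) (hz : bracketₗ α β F (basis α β F z) = 0) (x : ExtHV α β F) :
      bracketₗ α β F x (basis α β F z) = 0 := by
    rw [bracketₗ_swap, hz, LinearMap.zero_apply, neg_zero]
  have hr₁ := hr _ hl₁
  have hr₂ := hr _ hl₂
  have hr₃ := hr _ hl₃
  have h0 (x : ExtHV α β F) : (0 : ExtHV α β F →ₗ[ℂ] ExtHV α β F) x = 0 := rfl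
  cases a
  all_goals try simp only [hl₁, hl₂, hl₃, h0, map_zero, add_zero]
  all_goals cases b
  all_goals try simp only [hl₁, hl₂, hl₃, hr₁, hr₂, hr₃, h0, map_zero, add_zero]
  all_goals cases c
  all_goals try simp only [hr₁, hr₂, hr₃, map_zero, add_zero]
  all_goals rename_i m n p
  all_goals simp only [bracketₗ_basis, genBracket, L, J, G, C₁, C₂, C₃, map_add, map_sub,
    map_smul, map_zero, LinearMap.smul_apply, hl₁, hl₂, hl₃, hr₁, hr₂, hr₃, h0, smul_zero, add_zero, sub_zero]
  all_goals
    try simp only [Int.cast_add]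
    simp only [add_assoc, add_left_comm, add_comm]
    by_cases h : m + (n + p) = 0
    · obtain rfl : p = -m - n := by omega
      try simp only [h, if_true, Int.cast_sub, Int.cast_neg]
      match_scalars <;> ring
    · try simp only [h, if_false]
      match_scalars <;> ring

theorem bracketₗ_jacobi (x y z : ExtHV α β F) :
    bracketₗ α β F x (bracketₗ α β F y z) =
      bracketₗ α β F (bracketₗ α β F x y) z + bracketₗ α β F y (bracketₗ α β F x z) := by
  have hspan (w : ExtHV α β F) : w ∈ Submodule.span ℂ (Set.range (basis α β F)) :=
    (basis α β F).mem_span w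
  induction hspan x using Submodule.span_induction with
  | zero => simp
  | add u v _ _ hu hv => simp only [map_add, LinearMap.add_apply, hu, hv]; abel
  | smul t u _ hu => simp only [map_smul, LinearMap.smul_apply, hu, smul_add]
  | mem u hu =>
    obtain ⟨a, rfl⟩ := hu
    induction hspan y using Submodule.span_induction with
    | zero => simp
    | add u v _ _ hu hv => simp only [map_add, LinearMap.add_apply, hu, hv]; abel
    | smul t u _ hu => simp only [map_smul, LinearMap.smul_apply, hu, smul_add]
    | mem u hu =>
      obtain ⟨b, rfl⟩ := hu
      induction hspan z using Submodule.span_induction with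
      | zero => simp
      | add u v _ _ hu hv => simp only [map_add, hu, hv]; abel
      | smul t u _ hu => simp only [map_smul, hu, smul_add]
      | mem u hu =>
        obtain ⟨c, rfl⟩ := hu
        exact jacobi_basis α β F a b c

instance : LieRing (ExtHV α β F) where
  bracket x y := bracketₗ α β F x y
  add_lie x y z := by
    change bracketₗ α β F (x + y) z = _
    rw [map_add]; rfl
  lie_add x y z := map_add (bracketₗ α β F x) y z
  lie_self x := by
    have h := bracketₗ_swap α β F x x
    have h2 : (2 : ℂ) • bracketₗ α β F x x = 0 := by
      rw [two_smul]; nth_rewrite 1 [h]; exact neg_add_cancel _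
    exact (smul_eq_zero.mp h2).resolve_left two_ne_zero
  leibniz_lie x y z := bracketₗ_jacobi α β F x y z

instance : LieAlgebra ℂ (ExtHV α β F) where
  toModule := inferInstanceAs (Module ℂ (ExtHV α β F))
  lie_smul t x y := map_smul (bracketₗ α β F x) t y

/-- The spanning set `L_i, J_i, G_{-d+i}` (`i ≥ 0`), `C_1, C_2, C_3` of the subalgebra `𝓛_d`. -/
def posGens (d : ℕ) : Set (ExtHV α β F) :=
  {x | (∃ i : ℕ, x = L α β F i) ∨ (∃ i : ℕ, x = J α β F i) ∨
    (∃ i : ℕ, x = G α β F (-(d : ℤ) + i)) ∨ x = C₁ α β F ∨ x = C₂ α β F ∨ x = C₃ α β F}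

theorem bracketₗ_mem (d : ℕ) {x y : ExtHV α β F} (hx : x ∈ posGens α β F d)
    (hy : y ∈ posGens α β F d) :
    bracketₗ α β F x y ∈ Submodule.span ℂ (posGens α β F d) := by
  have hL (n : ℤ) (h : 0 ≤ n) : L α β F n ∈ Submodule.span ℂ (posGens α β F d) :=
    Submodule.subset_span (Or.inl ⟨n.toNat, by rw [Int.toNat_of_nonneg h]⟩)
  have hJ (n : ℤ) (h : 0 ≤ n) : J α β F n ∈ Submodule.span ℂ (posGens α β F d) :=
    Submodule.subset_span (Or.inr (Or.inl ⟨n.toNat, by rw [Int.toNat_of_nonneg h]⟩))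
  have hG (n : ℤ) (h : 0 ≤ d + n) : G α β F n ∈ Submodule.span ℂ (posGens α β F d) :=
    Submodule.subset_span (Or.inr (Or.inr (Or.inl ⟨(d + n).toNat, by
      rw [Int.toNat_of_nonneg h, neg_add_cancel_left]⟩)))
  have hC₁ : C₁ α β F ∈ Submodule.span ℂ (posGens α β F d) :=
    Submodule.subset_span (by simp [posGens])
  have hC₂ : C₂ α β F ∈ Submodule.span ℂ (posGens α β F d) :=
    Submodule.subset_span (by simp [posGens])
  have hC₃ : C₃ α β F ∈ Submodule.span ℂ (posGens α β F d) :=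
    Submodule.subset_span (by simp [posGens])
  rcases hx with ⟨i, rfl⟩ | ⟨i, rfl⟩ | ⟨i, rfl⟩ | rfl | rfl | rfl <;>
  rcases hy with ⟨j, rfl⟩ | ⟨j, rfl⟩ | ⟨j, rfl⟩ | rfl | rfl | rfl <;>
  first
  | rw [L, L, bracketₗ_basis, genBracket]
    exact add_mem (Submodule.smul_mem _ _ (hL _ (by omega))) (Submodule.smul_mem _ _ hC₁)
  | rw [L, J, bracketₗ_basis, genBracket]
    exact sub_mem (Submodule.smul_mem _ _ (hJ _ (by omega))) (Submodule.smul_mem _ _ hC₂)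
  | rw [L, J, bracketₗ_basis, genBracket]
    exact add_mem (Submodule.smul_mem _ _ (hJ _ (by omega))) (Submodule.smul_mem _ _ hC₂)
  | rw [J, J, bracketₗ_basis, genBracket]
    exact Submodule.smul_mem _ _ hC₃
  | rw [L, G, bracketₗ_basis, genBracket]
    exact Submodule.smul_mem _ _ (hG _ (by omega))
  | rw [J, G, bracketₗ_basis, genBracket]
    exact Submodule.smul_mem _ _ (hG _ (by omega))
  | simp only [L, J, G, C₁, C₂, C₃, bracketₗ_basis, genBracket, zero_mem]

/-- The subalgebra `𝓛_d`, the linear span of `L_i, J_i, G_{-d+i}` (`i ≥ 0`) and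
`C_1, C_2, C_3`. -/
def sub (d : ℕ) : LieSubalgebra ℂ (ExtHV α β F) where
  __ := Submodule.span ℂ (posGens α β F d)
  lie_mem' {x y} hx hy := by
    change bracketₗ α β F x y ∈ Submodule.span ℂ (posGens α β F d)
    induction hx using Submodule.span_induction with
    | zero => simp
    | add u v _ _ hu hv => rw [map_add, LinearMap.add_apply]; exact add_mem hu hv
    | smul t u _ hu => rw [map_smul, LinearMap.smul_apply]; exact Submodule.smul_mem _ t hu
    | mem x hx =>
      induction hy using Submodule.span_induction with
      | zero => simp
      | add u v _ _ hu hv => rw [map_add]; exact add_mem hu hv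
      | smul t u _ hu => rw [map_smul]; exact Submodule.smul_mem _ t hu
      | mem y hy => exact bracketₗ_mem α β F d hx hy

theorem L_mem (d i : ℕ) : L α β F i ∈ sub α β F d :=
  Submodule.subset_span (Or.inl ⟨i, rfl⟩)

theorem J_mem (d i : ℕ) : J α β F i ∈ sub α β F d :=
  Submodule.subset_span (Or.inr (Or.inl ⟨i, rfl⟩))

theorem G_mem (d i : ℕ) : G α β F i ∈ sub α β F d :=
  Submodule.subset_span (Or.inr (Or.inr (Or.inl ⟨d + i, by congr 1; push_cast; ring⟩)))

/-- `L_i` (`i ≥ 0`) as an element of `𝓛_d`. -/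
def subL (d i : ℕ) : sub α β F d := ⟨L α β F i, L_mem α β F d i⟩
/-- `J_i` (`i ≥ 0`) as an element of `𝓛_d`. -/
def subJ (d i : ℕ) : sub α β F d := ⟨J α β F i, J_mem α β F d i⟩
/-- `G_i` (`i ≥ 0`) as an element of `𝓛_d`. -/
def subG (d i : ℕ) : sub α β F d := ⟨G α β F i, G_mem α β F d i⟩

end ExtHV

end

open scoped TensorProduct

namespace LieInduction

attribute [local instance 100] LieRing.ofAssociativeRing

section Enveloping

variable {R : Type*} [CommRing R] {𝔤 : Type*} [LieRing 𝔤] [LieAlgebra R 𝔤]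

local notation "𝓤" => UniversalEnvelopingAlgebra R
local notation "ι𝓤" => UniversalEnvelopingAlgebra.ι R

/-- Induction on the enveloping algebra by left multiplication with elements of the Lie algebra. -/
theorem env_induction {P : 𝓤 𝔤 → Prop} (one : P 1) (add : ∀ u w, P u → P w → P (u + w))
    (smul : ∀ (t : R) u, P u → P (t • u)) (mul : ∀ x u, P u → P (ι𝓤 x * u)) (u : 𝓤 𝔤) : P u := by
  have key (a : TensorAlgebra R 𝔤) :
      ∀ w, P w → P (UniversalEnvelopingAlgebra.mkAlgHom R 𝔤 a * w) := by
    induction a using TensorAlgebra.induction with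
    | algebraMap r =>
      intro w hw
      rw [AlgHom.commutes, ← Algebra.smul_def]
      exact smul r w hw
    | ι x => exact fun w hw => mul x w hw
    | mul a b ha hb =>
      intro w hw
      rw [map_mul, mul_assoc]
      exact ha _ (hb _ hw)
    | add a b ha hb =>
      intro w hw
      rw [map_add, add_mul]
      exact add _ _ (ha _ hw) (hb _ hw)
  obtain ⟨a, rfl⟩ : ∃ a, UniversalEnvelopingAlgebra.mkAlgHom R 𝔤 a = u :=
    RingCon.mkₐ_surjective (UniversalEnvelopingAlgebra.ringCon R 𝔤) u
  simpa using key a 1 one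

variable (𝔫 𝔥 : LieSubalgebra R 𝔤) (V : Type*) [AddCommGroup V] [Module R V]

/-- The space `U(𝔫) ⊗ V`, on which `𝔤 = 𝔫 ⊕ 𝔥` is made to act. -/
abbrev Triang : Type _ := 𝓤 𝔫 ⊗[R] V

theorem triang_induction {P : Triang 𝔫 V → Prop} (one : ∀ v, P (1 ⊗ₜ v))
    (add : ∀ a b, P a → P b → P (a + b)) (smul : ∀ (t : R) a, P a → P (t • a))
    (mul : ∀ (x : 𝔫) a, P a → P (ι𝓤 x • a)) (a : Triang 𝔫 V) : P a := by
  induction a using TensorProduct.induction_on with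
  | zero => simpa using smul 0 _ (one 0)
  | add a b ha hb => exact add a b ha hb
  | tmul u v =>
    induction u using env_induction with
    | one => exact one v
    | add u w hu hw => rw [TensorProduct.add_tmul]; exact add _ _ hu hw
    | smul t u hu => rw [← TensorProduct.smul_tmul']; exact smul _ _ hu
    | mul x u hu => exact mul x _ hu

/-- The natural action of `𝔫` on linear maps `𝔤 → U(𝔫) ⊗ V`. -/
def jetAction : 𝔫 →ₗ⁅R⁆ Module.End R (𝔤 →ₗ[R] Triang 𝔫 V) where
  toFun n :=
    { toFun := fun ψ => Algebra.lsmul R R (Triang 𝔫 V) (ι𝓤 n) ∘ₗ ψ -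
        ψ ∘ₗ (LieAlgebra.ad R 𝔤 (n : 𝔤))
      map_add' := fun ψ χ => by ext x; simp; abel
      map_smul' := fun t ψ => by 
        ext x
        simpa [smul_sub] using smul_comm (UniversalEnvelopingAlgebra.mkAlgHom R 𝔫
          (TensorAlgebra.ι R n)) t (ψ x) }
  map_add' n n' := by ext ψ x; simp; abel
  map_smul' t n := by ext ψ x; simp [smul_sub]
  map_lie' {n n'} := by
    ext ψ x
    simp [LieRing.of_associative_ring_bracket, smul_sub]
    abel

theorem jetAction_apply (n : 𝔫) (ψ : 𝔤 →ₗ[R] Triang 𝔫 V) (x : 𝔤) :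
    jetAction 𝔫 V n ψ x = ι𝓤 n • ψ x - ψ ⁅(n : 𝔤), x⁆ := rfl

variable {𝔫 𝔥} [LieRingModule 𝔥 V] [LieModule R 𝔥 V]
  (hc : IsCompl 𝔫.toSubmodule 𝔥.toSubmodule)

/-- The `𝔫`-component of an element of `𝔤 = 𝔫 ⊕ 𝔥`. -/
noncomputable def projLeft : 𝔤 →ₗ[R] 𝔫 := Submodule.projectionOnto _ _ hc

/-- The `𝔥`-component of an element of `𝔤 = 𝔫 ⊕ 𝔥`. -/
noncomputable def projRight : 𝔤 →ₗ[R] 𝔥 := Submodule.projectionOnto _ _ hc.symm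

theorem projLeft_left (n : 𝔫) : projLeft hc n = n := Submodule.projectionOnto_apply_left hc n

theorem projLeft_right (h : 𝔥) : projLeft hc h = 0 := Submodule.projectionOnto_apply_right hc h

theorem projRight_left (n : 𝔫) : projRight hc n = 0 :=
  Submodule.projectionOnto_apply_right hc.symm n

theorem projRight_right (h : 𝔥) : projRight hc h = h :=
  Submodule.projectionOnto_apply_left hc.symm h

theorem projLeft_add_projRight (x : 𝔤) : (projLeft hc x : 𝔤) + projRight hc x = x :=
  Submodule.projection_add_projection_eq_self hc x

/-- The map `v ↦ (x ↦ x · (1 ⊗ v))` that prescribes the action of `𝔤` on `1 ⊗ V`. -/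
noncomputable def jetBase : V →ₗ[R] 𝔤 →ₗ[R] Triang 𝔫 V :=
  LinearMap.mk₂ R (fun v x => ι𝓤 (projLeft hc x) ⊗ₜ v + 1 ⊗ₜ ⁅projRight hc x, v⁆)
    (fun v w x => by simp only [lie_add, TensorProduct.tmul_add]; abel)
    (fun t v x => by simp only [lie_smul, TensorProduct.tmul_smul, smul_add])
    (fun v x y => by
      simp only [map_add, add_lie, TensorProduct.tmul_add, TensorProduct.add_tmul]; abel)
    (fun t v x => by
      simp only [map_smul, smul_lie, TensorProduct.tmul_smul, TensorProduct.smul_tmul', smul_add])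

/-- The map `a ↦ (x ↦ x · a)`, the `𝔫`-equivariant extension of `jetBase`. -/
noncomputable def jet : Triang 𝔫 V →ₗ[R] 𝔤 →ₗ[R] Triang 𝔫 V :=
  TensorProduct.lift
    (LinearMap.lcomp R _ (jetBase V hc) ∘ₗ
      (UniversalEnvelopingAlgebra.lift R (jetAction 𝔫 V)).toLinearMap)

theorem jet_one_tmul (v : V) (x : 𝔤) :
    jet V hc (1 ⊗ₜ v) x = ι𝓤 (projLeft hc x) ⊗ₜ v + 1 ⊗ₜ ⁅projRight hc x, v⁆ := by
  simp only [jet, TensorProduct.lift.tmul, LinearMap.comp_apply, AlgHom.toLinearMap_apply, map_one,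
    LinearMap.lcomp_apply, Module.End.one_apply]
  rfl

theorem jet_smul (n : 𝔫) (a : Triang 𝔫 V) (x : 𝔤) :
    jet V hc (ι𝓤 n • a) x = ι𝓤 n • jet V hc a x - jet V hc a ⁅(n : 𝔤), x⁆ := by
  rw [← jetAction_apply]
  congr 1
  induction a using TensorProduct.induction_on with
  | zero => simp
  | add a b ha hb => rw [smul_add, map_add, map_add, map_add, ha, hb]
  | tmul u v =>
    rw [TensorProduct.smul_tmul', smul_eq_mul]
    simp only [jet, TensorProduct.lift.tmul, LinearMap.comp_apply, AlgHom.toLinearMap_apply,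
      LinearMap.lcomp_apply, map_mul, Module.End.mul_apply, UniversalEnvelopingAlgebra.lift_ι_apply]

theorem jet_left (n : 𝔫) (a : Triang 𝔫 V) : jet V hc a n = ι𝓤 n • a := by
  induction a using triang_induction generalizing n with
  | one v =>
    rw [jet_one_tmul, projLeft_left, projRight_left, zero_lie, TensorProduct.tmul_zero, add_zero,
      TensorProduct.smul_tmul', smul_eq_mul, mul_one]
  | add a b ha hb => rw [map_add, LinearMap.add_apply, ha, hb, smul_add]
  | smul t a ha => rw [map_smul, LinearMap.smul_apply, ha, smul_comm]
  | mul n' a ha =>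
    rw [jet_smul, ha, ← LieSubalgebra.coe_bracket, ha, LieHom.map_lie,
      LieRing.of_associative_ring_bracket, sub_smul, mul_smul, mul_smul, sub_sub_cancel]

theorem jet_lie (x y : 𝔤) (a : Triang 𝔫 V) :
    jet V hc a ⁅x, y⁆ = jet V hc (jet V hc a y) x - jet V hc (jet V hc a x) y := by
  have left (n : 𝔫) (y : 𝔤) (a : Triang 𝔫 V) : jet V hc a ⁅(n : 𝔤), y⁆ =
      jet V hc (jet V hc a y) n - jet V hc (jet V hc a n) y := by
    rw [jet_left, jet_left, jet_smul, sub_sub_cancel]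
  induction a using triang_induction generalizing x y with
  | one v =>
    have right (h h' : 𝔥) : jet V hc (1 ⊗ₜ v) ⁅(h : 𝔤), (h' : 𝔤)⁆ =
        jet V hc (jet V hc (1 ⊗ₜ v) h') h - jet V hc (jet V hc (1 ⊗ₜ v) h) h' := by
      rw [← LieSubalgebra.coe_bracket]
      simp only [jet_one_tmul, projLeft_right, projRight_right, map_zero, TensorProduct.zero_tmul,
        zero_add]
      rw [← TensorProduct.tmul_sub, lie_lie]
    have swap (h : 𝔥) (n : 𝔫) : jet V hc (1 ⊗ₜ v) ⁅(h : 𝔤), (n : 𝔤)⁆ =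
        jet V hc (jet V hc (1 ⊗ₜ v) n) h - jet V hc (jet V hc (1 ⊗ₜ v) h) n := by
      rw [← lie_skew, map_neg, left, neg_sub]
    rw [← projLeft_add_projRight hc x, ← projLeft_add_projRight hc y]
    generalize projLeft hc x = n, projRight hc x = h, projLeft hc y = n', projRight hc y = h'
    simp only [add_lie, lie_add, map_add, LinearMap.add_apply, left, right, swap]
    abel
  | add a b ha hb => simp only [map_add, LinearMap.add_apply, ha, hb]; abel
  | smul t a ha => simp only [map_smul, LinearMap.smul_apply, ha, smul_sub]
  | mul n a ha =>
    simp only [jet_smul, map_sub, LinearMap.sub_apply, ha, leibniz_lie (n : 𝔤) x y, map_add,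
      smul_sub]
    abel

/-- The action of `𝔤 = 𝔫 ⊕ 𝔥` on `U(𝔫) ⊗ V`. -/
noncomputable def triangAction : 𝔤 →ₗ⁅R⁆ Module.End R (Triang 𝔫 V) where
  __ := (jet V hc).flip
  map_lie' {x y} := by
    exact LinearMap.ext fun a => jet_lie V hc x y a

theorem triangAction_apply (x : 𝔤) (a : Triang 𝔫 V) : triangAction V hc x a = jet V hc a x := rfl

/-- The comparison map from `U(𝔤) ⊗ V` to `U(𝔫) ⊗ V`. -/
noncomputable def toTriang : 𝓤 𝔤 ⊗[R] V →ₗ[R] Triang 𝔫 V :=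
  TensorProduct.lift
    (LinearMap.lcomp R _ (TensorProduct.mk R (𝓤 𝔫) V 1) ∘ₗ
      (UniversalEnvelopingAlgebra.lift R (triangAction V hc)).toLinearMap)

theorem toTriang_tmul (u : 𝓤 𝔤) (v : V) : toTriang V hc (u ⊗ₜ v) =
    UniversalEnvelopingAlgebra.lift R (triangAction V hc) u (1 ⊗ₜ v) := rfl

theorem toTriang_smul (u : 𝓤 𝔤) (a : 𝓤 𝔤 ⊗[R] V) : toTriang V hc (u • a) =
    UniversalEnvelopingAlgebra.lift R (triangAction V hc) u (toTriang V hc a) := by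
  induction a using TensorProduct.induction_on with
  | zero => simp
  | add a b ha hb => rw [smul_add, map_add, map_add, map_add, ha, hb]
  | tmul w v =>
    rw [TensorProduct.smul_tmul', smul_eq_mul, toTriang_tmul, toTriang_tmul, map_mul,
      Module.End.mul_apply]

theorem lift_triangAction_envIncl (w : 𝓤 𝔥) (v : V) :
    UniversalEnvelopingAlgebra.lift R (triangAction V hc) (envIncl R 𝔥 w) (1 ⊗ₜ v) =
      1 ⊗ₜ envAction R 𝔥 V w v := by
  induction w using env_induction with
  | one => simp
  | add u w hu hw => simp only [map_add, LinearMap.add_apply, hu, hw, TensorProduct.tmul_add]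
  | smul t u hu => simp only [map_smul, LinearMap.smul_apply, hu, TensorProduct.tmul_smul]
  | mul h u hu =>
    rw [map_mul, map_mul, map_mul, Module.End.mul_apply, Module.End.mul_apply, hu, envIncl,
      envAction, UniversalEnvelopingAlgebra.lift_ι_apply, UniversalEnvelopingAlgebra.lift_ι_apply,
      LieHom.comp_apply, UniversalEnvelopingAlgebra.lift_ι_apply, triangAction_apply,
      LieSubalgebra.coe_incl, jet_one_tmul, projLeft_right, projRight_right, map_zero,
      TensorProduct.zero_tmul, zero_add, LieModule.toEnd_apply_apply]

theorem toTriang_eq_zero {a : 𝓤 𝔤 ⊗[R] V} (ha : a ∈ relations R 𝔥 V) : toTriang V hc a = 0 := by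
  induction ha using Submodule.span_induction with
  | zero => exact map_zero _
  | add a b _ _ ha hb => rw [map_add, ha, hb, add_zero]
  | smul u a _ ha => rw [toTriang_smul, ha, map_zero]
  | mem a ha =>
    obtain ⟨u, w, v, rfl⟩ := ha
    rw [map_sub, toTriang_tmul, toTriang_tmul, map_mul, Module.End.mul_apply,
      lift_triangAction_envIncl, sub_self]

variable (R 𝔥) in
/-- The canonical map `v ↦ 1 ⊗ v` from `V` to the induced module. -/
noncomputable def incl : V →ₗ[R] Ind R 𝔥 V :=
  ((relations R 𝔥 V).mkQ.restrictScalars R) ∘ₗ TensorProduct.mk R (𝓤 𝔤) V 1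

theorem lie_incl (h : 𝔥) (v : V) : ⁅(h : 𝔤), incl R 𝔥 V v⁆ = incl R 𝔥 V ⁅h, v⁆ := by
  refine (Submodule.Quotient.eq (relations R 𝔥 V)).mpr (Submodule.subset_span ⟨1, ι𝓤 h, v, ?_⟩)
  rw [envIncl, envAction, UniversalEnvelopingAlgebra.lift_ι_apply,
    UniversalEnvelopingAlgebra.lift_ι_apply, one_mul]
  change (ι𝓤 (h : 𝔤) * 1) ⊗ₜ[R] v - _ = _
  rw [mul_one]
  rfl

include hc in
/-- The canonical map from `V` to the induced module is injective if `𝔥` has a complement in `𝔤`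
that is a subalgebra. -/
theorem incl_injective : Function.Injective (incl R 𝔥 V) := by
  rw [injective_iff_map_eq_zero]
  intro v hv
  have h := toTriang_eq_zero V hc ((Submodule.Quotient.mk_eq_zero (relations R 𝔥 V)).mp hv)
  have h' : toTriang V hc (TensorProduct.mk R (𝓤 𝔤) V 1 v) = 1 ⊗ₜ v := by
    rw [TensorProduct.mk_apply, toTriang_tmul, map_one, Module.End.one_apply]
  rw [h'] at h
  have := congrArg (TensorProduct.lid R V ∘
    LinearMap.rTensor V (UniversalEnvelopingAlgebra.lift R (0 : 𝔫 →ₗ⁅R⁆ R)).toLinearMap) h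
  simpa using this

/-- A submodule of the induced module that contains `1 ⊗ V` is everything. -/
theorem eq_top_of_incl_mem (N : LieSubmodule R 𝔤 (Ind R 𝔥 V)) (hN : ∀ v, incl R 𝔥 V v ∈ N) :
    N = ⊤ := by
  suffices h : ∀ a, a ∈ N from eq_top_iff.mpr fun a _ => h a
  intro a
  obtain ⟨a, rfl⟩ := Submodule.Quotient.mk_surjective _ a
  induction a using TensorProduct.induction_on with
  | zero => exact zero_mem N
  | add a b ha hb => exact add_mem ha hb
  | tmul u v =>
    induction u using env_induction with
    | one => exact hN v
    | add u w hu hw => rw [TensorProduct.add_tmul]; exact add_mem hu hw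
    | smul t u hu => rw [← TensorProduct.smul_tmul']; exact N.smul_mem t hu
    | mul x u hu => exact N.lie_mem (x := x) hu

end Enveloping

end LieInduction

namespace ExtHV

section Generators

variable (α β F : ℂ) (d : ℕ)

/-- The generators `L_m`, `J_m` and `G_{m-d}` in a uniform notation. With this shift of the index
of `G`, the subalgebra `𝓛_d` is spanned by the generators of index `m ≥ 0` and the centre. -/
noncomputable def gen (a : Fin 3) (m : ℤ) : ExtHV α β F :=
  match a with
  | 0 => L α β F m
  | 1 => J α β F m
  | 2 => G α β F (m - d)

/-- The span of the central basis vectors. -/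
noncomputable def centre : Submodule ℂ (ExtHV α β F) := Submodule.span ℂ {C₁ α β F, C₂ α β F, C₃ α β F}

variable {α β F}

theorem lie_basis (a b : Gen) : ⁅basis α β F a, basis α β F b⁆ = genBracket α β F a b :=
  bracketₗ_basis α β F a b

theorem lie_eq_zero_of_mem_centre {z : ExtHV α β F} (hz : z ∈ centre α β F) (x : ExtHV α β F) :
    ⁅z, x⁆ = 0 := by
  have key (c : Gen) (hc : ∀ b, genBracket α β F c b = 0) : ⁅basis α β F c, x⁆ = 0 := by
    induction (basis α β F).mem_span x using Submodule.span_induction with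
    | zero => exact lie_zero _
    | add u v _ _ hu hv => rw [lie_add, hu, hv, add_zero]
    | smul t u _ hu => rw [lie_smul, hu, smul_zero]
    | mem u hu =>
      obtain ⟨b, rfl⟩ := hu
      rw [lie_basis, hc]
  induction hz using Submodule.span_induction with
  | zero => exact zero_lie _
  | add u v _ _ hu hv => rw [add_lie, hu, hv, add_zero]
  | smul t u _ hu => rw [smul_lie, hu, smul_zero]
  | mem u hu =>
    rcases hu with rfl | rfl | rfl
    all_goals exact key _ fun b => by cases b <;> rfl

/-- The structure constants of the generators, up to the centre. -/
noncomputable def coeff (α β F : ℂ) (d : ℕ) : Fin 3 → Fin 3 → ℤ → ℤ → ℂ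
  | 0, 0, m, n => m - n
  | 0, 1, _, n => -n
  | 1, 0, m, _ => m
  | 0, 2, m, n => -(α + (n - d) + m * β)
  | 2, 0, m, n => α + (m - d) + n * β
  | 1, 2, _, _ => F
  | 2, 1, _, _ => -F
  | 1, 1, _, _ => 0
  | 2, 2, _, _ => 0

theorem lie_gen (a b : Fin 3) (m n : ℤ) : ∃ z ∈ centre α β F, (m + n ≠ 0 → z = 0) ∧
    ⁅gen α β F d a m, gen α β F d b n⁆ =
      coeff α β F d a b m n • gen α β F d (a ⊔ b) (m + n) + z := by
  have hC₁ : C₁ α β F ∈ centre α β F := Submodule.subset_span (by simp)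
  have hC₂ : C₂ α β F ∈ centre α β F := Submodule.subset_span (by simp)
  have hC₃ : C₃ α β F ∈ centre α β F := Submodule.subset_span (by simp)
  have e₁ : m + (n - d) = m + n - d := by ring
  have e₂ : n + (m - d) = m + n - d := by ring
  fin_cases a <;> fin_cases b
  · exact ⟨_, Submodule.smul_mem _ _ hC₁, fun h => by rw [if_neg h, zero_smul], lie_basis _ _⟩
  · refine ⟨_, neg_mem (Submodule.smul_mem _ _ hC₂), fun h => by rw [if_neg h, zero_smul, neg_zero],
      (lie_basis _ _).trans (sub_eq_add_neg _ _)⟩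
  · refine ⟨0, zero_mem _, fun _ => rfl, (lie_basis _ _).trans ?_⟩
    rw [genBracket, e₁]
    simp [gen, coeff]
  · refine ⟨_, Submodule.smul_mem _ (if n + m = 0 then (n : ℂ) ^ 2 + n else 0) hC₂,
      fun h => by rw [if_neg (by rwa [add_comm]), zero_smul], (lie_basis _ _).trans ?_⟩
    rw [genBracket, add_comm n m]
    rfl
  · refine ⟨_, Submodule.smul_mem _ (if m + n = 0 then (m : ℂ) else 0) hC₃,
      fun h => by rw [if_neg h, zero_smul], (lie_basis _ _).trans ?_⟩
    simp [genBracket, coeff]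
  · refine ⟨0, zero_mem _, fun _ => rfl, (lie_basis _ _).trans ?_⟩
    rw [genBracket, e₁]
    simp [gen, coeff]
  · refine ⟨0, zero_mem _, fun _ => rfl, (lie_basis _ _).trans ?_⟩
    rw [genBracket, e₂]
    simp [gen, coeff]
  · refine ⟨0, zero_mem _, fun _ => rfl, (lie_basis _ _).trans ?_⟩
    rw [genBracket, e₂]
    simp [gen, coeff]
  · refine ⟨0, zero_mem _, fun _ => rfl, (lie_basis _ _).trans ?_⟩
    simp [genBracket, coeff]

theorem lie_gen_of_ne (a b : Fin 3) {m n : ℤ} (h : m + n ≠ 0) :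
    ⁅gen α β F d a m, gen α β F d b n⁆ =
      coeff α β F d a b m n • gen α β F d (a ⊔ b) (m + n) := by
  obtain ⟨z, -, hz, e⟩ := lie_gen (α := α) (β := β) (F := F) d a b m n
  rw [e, hz h, add_zero]

theorem basis_mem (c : Gen) :
    basis α β F c ∈ centre α β F ∨ ∃ a m, basis α β F c = gen α β F d a m := by
  cases c with
  | L m => exact .inr ⟨0, m, rfl⟩
  | J m => exact .inr ⟨1, m, rfl⟩
  | G m => exact .inr ⟨2, m + d, by simp [gen, G]⟩
  | C₁ => exact .inl (Submodule.subset_span (by simp [C₁]))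
  | C₂ => exact .inl (Submodule.subset_span (by simp [C₂]))
  | C₃ => exact .inl (Submodule.subset_span (by simp [C₃]))

end Generators

section Words

variable {α β F : ℂ} {d : ℕ} {W : Type*} [AddCommGroup W] [Module ℂ W]
  [LieRingModule (ExtHV α β F) W] [LieModule ℂ (ExtHV α β F) W]

/-- The generators of negative index: the letter `(n, a)` stands for `gen a (-(n + 1))`. -/
def Letter : Type := ℕ ×ₗ Fin 3

noncomputable instance : LinearOrder Letter := inferInstanceAs (LinearOrder (ℕ ×ₗ Fin 3))

/-- The weight of a letter. -/
def Letter.weight (x : Letter) : ℤ := (ofLex x).1 + 1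

theorem Letter.weight_pos (x : Letter) : 1 ≤ x.weight := by
  unfold Letter.weight
  omega

/-- The kind of a letter. -/
def Letter.kind (x : Letter) : Fin 3 := (ofLex x).2

theorem Letter.ext_weight_kind {x y : Letter} (h : x.weight = y.weight) (h' : x.kind = y.kind) :
    x = y := by
  unfold Letter.weight at h
  exact ofLex.injective (Prod.ext (by omega) h')

theorem Letter.exists_eq (a : Fin 3) {m : ℤ} (hm : m < 0) :
    ∃ x : Letter, x.weight = -m ∧ x.kind = a :=
  ⟨toLex (((-m - 1).toNat : ℕ), a), by simp only [Letter.weight, ofLex_toLex]; omega, rfl⟩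

variable (α β F d) in
/-- The generator for which a letter stands. -/
noncomputable def Letter.val (x : Letter) : ExtHV α β F := gen α β F d x.kind (-x.weight)

/-- The weight of a word. -/
def wordWeight (w : List Letter) : ℤ := (w.map Letter.weight).sum

@[simp] theorem wordWeight_nil : wordWeight [] = 0 := rfl

@[simp] theorem wordWeight_cons (x : Letter) (w : List Letter) :
    wordWeight (x :: w) = x.weight + wordWeight w := List.sum_cons

theorem wordWeight_nonneg (w : List Letter) : 0 ≤ wordWeight w := by
  induction w with
  | nil => simp
  | cons x w ih => have := x.weight_pos; rw [wordWeight_cons]; omega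

theorem wordWeight_perm {w w' : List Letter} (h : w.Perm w') : wordWeight w = wordWeight w' :=
  (h.map _).sum_eq

theorem le_wordWeight {x : Letter} {w : List Letter} (h : x ∈ w) : x.weight ≤ wordWeight w := by
  rw [wordWeight_perm (List.perm_cons_erase h), wordWeight_cons]
  have := wordWeight_nonneg (w.erase x)
  omega

variable (α β F d W) in
/-- The action of a word on a module. -/
noncomputable def word : List Letter → W →ₗ[ℂ] W
  | [] => LinearMap.id
  | x :: w => LieModule.toEnd ℂ (ExtHV α β F) W (x.val α β F d) ∘ₗ word w

@[simp] theorem word_nil (y : W) : word α β F d W [] y = y := rfl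

@[simp] theorem word_cons (x : Letter) (w : List Letter) (y : W) :
    word α β F d W (x :: w) y = ⁅x.val α β F d, word α β F d W w y⁆ := rfl

variable (d) in
/-- The subspace spanned by the words of weight at most `q`, applied to the subspace `B`. -/
def filt (B : Submodule ℂ W) (q : ℤ) : Submodule ℂ W :=
  Submodule.span ℂ {y | ∃ w, ∃ b ∈ B, wordWeight w ≤ q ∧ y = word α β F d W w b}

variable {B : Submodule ℂ W}

theorem word_mem_filt {w : List Letter} {b : W} (hb : b ∈ B) {q : ℤ} (h : wordWeight w ≤ q) :
    word α β F d W w b ∈ filt (α := α) (β := β) (F := F) d B q :=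
  Submodule.subset_span ⟨w, b, hb, h, rfl⟩

local notation "𝓜" => filt (α := α) (β := β) (F := F) d

theorem filt_mono {q r : ℤ} (h : q ≤ r) : 𝓜 B q ≤ 𝓜 B r :=
  Submodule.span_mono fun _ ⟨w, b, hb, hw, e⟩ => ⟨w, b, hb, hw.trans h, e⟩

theorem eq_zero_of_mem_filt {q : ℤ} (hq : q < 0) {y : W} (hy : y ∈ 𝓜 B q) : y = 0 := by
  induction hy using Submodule.span_induction with
  | zero => rfl
  | add u v _ _ hu hv => rw [hu, hv, add_zero]
  | smul t u _ hu => rw [hu, smul_zero]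
  | mem y hy =>
    obtain ⟨w, b, _, hw, _⟩ := hy
    have := wordWeight_nonneg w
    omega

theorem letter_mem_filt (x : Letter) {q r : ℤ} {y : W} (hy : y ∈ 𝓜 B q) (h : q + x.weight ≤ r) :
    ⁅x.val α β F d, y⁆ ∈ 𝓜 B r := by
  induction hy using Submodule.span_induction with
  | zero => rw [lie_zero]; exact zero_mem _
  | add u v _ _ hu hv => rw [lie_add]; exact add_mem hu hv
  | smul t u _ hu => rw [lie_smul]; exact Submodule.smul_mem _ _ hu
  | mem y hy =>
    obtain ⟨w, b, hb, hw, rfl⟩ := hy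
    rw [← word_cons]
    exact word_mem_filt hb (by rw [wordWeight_cons]; omega)

/-- The indices from which on the generators of the three kinds act by zero. -/
def threshold (K l : ℤ) : Fin 3 → ℤ := ![l, K, K]

theorem threshold_sup_le {K l : ℤ} (h : K < l) (a b : Fin 3) :
    threshold K l (a ⊔ b) ≤ threshold K l a := by
  fin_cases a <;> fin_cases b <;> simp [threshold] <;> omega

theorem one_le_threshold {K l : ℤ} (h : 1 ≤ K) (h' : K < l) (a : Fin 3) :
    1 ≤ threshold K l a := by
  fin_cases a <;> simp [threshold] <;> omega

variable (d) in
/-- The properties of the image of `V` in the induced module on which the proof depends. -/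
structure IsBottom (K l : ℤ) (B : Submodule ℂ W) : Prop where
  one_le : 1 ≤ K
  lt : K < l
  gen_mem : ∀ a m, 0 ≤ m → ∀ b ∈ B, ⁅gen α β F d a m, b⁆ ∈ B
  centre_mem : ∀ z ∈ centre α β F, ∀ b ∈ B, ⁅z, b⁆ ∈ B
  gen_eq_zero : ∀ a m, threshold K l a < m → ∀ b ∈ B, ⁅gen α β F d a m, b⁆ = 0
  eq_zero_of_L : ∀ b ∈ B, ⁅gen α β F d 0 l, b⁆ = 0 → b = 0
  eq_zero_of_G : ∀ b ∈ B, ⁅gen α β F d 2 K, b⁆ = 0 → b = 0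

/-- A bound for the shift of the filtration by the generator `gen a m`. -/
def order (K l : ℤ) (a : Fin 3) (m : ℤ) : ℤ := max (-m) (min 0 (threshold K l a - m))

variable {K l : ℤ} (hB : IsBottom (α := α) (β := β) (F := F) d K l B)

include hB

theorem IsBottom.centre_mem_filt {z : ExtHV α β F} (hz : z ∈ centre α β F) {q : ℤ} {y : W}
    (hy : y ∈ 𝓜 B q) : ⁅z, y⁆ ∈ 𝓜 B q := by
  induction hy using Submodule.span_induction with
  | zero => rw [lie_zero]; exact zero_mem _
  | add u v _ _ hu hv => rw [lie_add]; exact add_mem hu hv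
  | smul t u _ hu => rw [lie_smul]; exact Submodule.smul_mem _ _ hu
  | mem y hy =>
    obtain ⟨w, b, hb, hw, rfl⟩ := hy
    have : ⁅z, word α β F d W w b⁆ = word α β F d W w ⁅z, b⁆ := by
      clear hw
      induction w with
      | nil => rfl
      | cons x w ih =>
        rw [word_cons, leibniz_lie, lie_eq_zero_of_mem_centre hz, zero_lie, zero_add, ih, word_cons]
    rw [this]
    exact word_mem_filt (hB.centre_mem z hz b hb) hw

theorem IsBottom.gen_word_mem_filt (a : Fin 3) (m : ℤ) (w : List Letter) {b : W} (hb : b ∈ B)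
    {r : ℤ} (h : wordWeight w + order K l a m ≤ r) :
    ⁅gen α β F d a m, word α β F d W w b⁆ ∈ 𝓜 B r := by
  induction w generalizing a m r with
  | nil =>
    rw [word_nil]
    rw [wordWeight_nil, order] at h
    by_cases hm : m < 0
    · obtain ⟨x, hx, rfl⟩ := Letter.exists_eq a hm
      have e : gen α β F d x.kind m = x.val α β F d := by rw [Letter.val, hx, neg_neg]
      rw [e]
      exact letter_mem_filt (q := 0) x (word_mem_filt (w := []) hb le_rfl) (by omega)
    · by_cases ht : threshold K l a < m
      · rw [hB.gen_eq_zero a m ht b hb]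
        exact zero_mem _
      · exact word_mem_filt (w := []) (hB.gen_mem a m (by omega) b hb)
          (by rw [wordWeight_nil]; omega)
  | cons x w ih =>
    rw [wordWeight_cons] at h
    rw [word_cons, leibniz_lie]
    refine add_mem ?_ (letter_mem_filt x (ih a m le_rfl) (by omega))
    obtain ⟨z, hz, hz', e⟩ := lie_gen (α := α) (β := β) (F := F) d a x.kind m (-x.weight)
    rw [Letter.val, e, add_lie, smul_lie]
    have := threshold_sup_le hB.lt a x.kind
    have := x.weight_pos
    simp only [order] at h
    refine add_mem (Submodule.smul_mem _ _ (ih _ _ (by simp only [order]; omega))) ?_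
    by_cases hm : m + -x.weight = 0
    · exact filt_mono (by omega) (hB.centre_mem_filt hz (word_mem_filt hb le_rfl))
    · rw [hz' hm, zero_lie]
      exact zero_mem _

theorem IsBottom.gen_mem_filt (a : Fin 3) (m : ℤ) {q r : ℤ} {y : W} (hy : y ∈ 𝓜 B q)
    (h : q + order K l a m ≤ r) : ⁅gen α β F d a m, y⁆ ∈ 𝓜 B r := by
  induction hy using Submodule.span_induction with
  | zero => rw [lie_zero]; exact zero_mem _
  | add u v _ _ hu hv => rw [lie_add]; exact add_mem hu hv
  | smul t u _ hu => rw [lie_smul]; exact Submodule.smul_mem _ _ hu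
  | mem y hy =>
    obtain ⟨w, b, hb, hw, rfl⟩ := hy
    exact hB.gen_word_mem_filt a m w hb (by omega)

theorem IsBottom.lie_mem_filt (a b : Fin 3) (m n : ℤ) {q r : ℤ} {y : W} (hy : y ∈ 𝓜 B q)
    (h : q + order K l (a ⊔ b) (m + n) ≤ r) (h' : m + n = 0 → q ≤ r) :
    ⁅⁅gen α β F d a m, gen α β F d b n⁆, y⁆ ∈ 𝓜 B r := by
  obtain ⟨z, hz, hz', e⟩ := lie_gen (α := α) (β := β) (F := F) d a b m n
  rw [e, add_lie, smul_lie]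
  refine add_mem (Submodule.smul_mem _ _ (hB.gen_mem_filt _ _ hy h)) ?_
  by_cases hm : m + n = 0
  · exact filt_mono (h' hm) (hB.centre_mem_filt hz hy)
  · rw [hz' hm, zero_lie]
    exact zero_mem _

/-- Generators of positive index commute with words up to terms of lower weight. -/
theorem IsBottom.gen_word_sub_mem (a : Fin 3) {m : ℤ} (hm : 1 ≤ m) (w : List Letter) {b : W}
    (hb : b ∈ B) : ⁅gen α β F d a m, word α β F d W w b⁆ -
      word α β F d W w ⁅gen α β F d a m, b⁆ ∈ 𝓜 B (wordWeight w - 1) := by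
  induction w with
  | nil => rw [word_nil, word_nil, sub_self]; exact zero_mem _
  | cons x w ih =>
    have := x.weight_pos
    rw [word_cons, word_cons, leibniz_lie, add_sub_assoc, ← lie_sub, wordWeight_cons]
    refine add_mem (hB.lie_mem_filt _ _ _ _ (word_mem_filt hb le_rfl) ?_ (by omega))
      (letter_mem_filt x ih (by omega))
    simp only [order]
    omega

theorem IsBottom.lie_word_sub_mem (a b : Fin 3) {m n : ℤ} (hm : 1 ≤ m + n) (w : List Letter)
    {c : W} (hc : c ∈ B) : ⁅⁅gen α β F d a m, gen α β F d b n⁆, word α β F d W w c⁆ -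
      word α β F d W w ⁅⁅gen α β F d a m, gen α β F d b n⁆, c⁆ ∈ 𝓜 B (wordWeight w - 1) := by
  rw [lie_gen_of_ne d a b (by omega), smul_lie, smul_lie, map_smul, ← smul_sub]
  exact Submodule.smul_mem _ _ (hB.gen_word_sub_mem _ hm w hc)

/-- The leading term of the action of `gen a (threshold a + i)` on a sorted word with letters of
weight at least `i`, if `x` is the only letter of weight `i` that contributes. -/
theorem IsBottom.leading_term (a : Fin 3) (x : Letter) {b : W} (hb : b ∈ B) (w : List Letter)
    (hw : w.Pairwise (· ≤ ·)) (hi : ∀ y ∈ w, x.weight ≤ y.weight)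
    (hx : ∀ y ∈ w, y ≠ x → y.weight = x.weight →
      ⁅⁅gen α β F d a (threshold K l a + x.weight), y.val α β F d⁆, b⁆ = 0) :
    ⁅gen α β F d a (threshold K l a + x.weight), word α β F d W w b⁆ -
      w.count x • word α β F d W (w.erase x)
        ⁅⁅gen α β F d a (threshold K l a + x.weight), x.val α β F d⁆, b⁆ ∈
      𝓜 B (wordWeight w - x.weight - 1) := by
  have hxp := x.weight_pos
  have hta := one_le_threshold hB.one_le hB.lt a
  set g := gen α β F d a (threshold K l a + x.weight) with hg
  induction w with
  | nil =>
    rw [List.count_nil, zero_smul, sub_zero, word_nil, hB.gen_eq_zero a _ (by omega) b hb]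
    exact zero_mem _
  | cons y w ih =>
    have ih := ih hw.of_cons (fun z hz => hi z (List.mem_cons_of_mem _ hz))
      (fun z hz => hx z (List.mem_cons_of_mem _ hz))
    rw [word_cons, leibniz_lie]
    have hyi := hi y List.mem_cons_self
    have hcomm (hy : y.weight = x.weight) : ⁅⁅g, y.val α β F d⁆, word α β F d W w b⁆ -
        word α β F d W w ⁅⁅g, y.val α β F d⁆, b⁆ ∈ 𝓜 B (wordWeight w - 1) :=
      hB.lie_word_sub_mem _ _ (by omega) w hb
    by_cases hyx : y = x
    · subst hyx
      have h₁ := letter_mem_filt y ih (r := y.weight + wordWeight w - y.weight - 1) (by omega)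
      rw [lie_sub, lie_nsmul, ← word_cons] at h₁
      have h₂ : w.count y • word α β F d W (y :: w.erase y) ⁅⁅g, y.val α β F d⁆, b⁆ =
          w.count y • word α β F d W w ⁅⁅g, y.val α β F d⁆, b⁆ := by
        cases w with
        | nil => simp
        | cons z w =>
          by_cases hyz : y ∈ z :: w
          · obtain rfl : z = y := by
              rcases List.mem_cons.mp hyz with h | h
              · exact h.symm
              · exact le_antisymm (List.rel_of_pairwise_cons hw.of_cons h)
                  (List.rel_of_pairwise_cons hw List.mem_cons_self)
            rw [List.erase_cons_head]
          · rw [List.count_eq_zero_of_not_mem hyz, zero_smul, zero_smul]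
      rw [h₂] at h₁
      rw [List.erase_cons_head, List.count_cons_self, succ_nsmul, wordWeight_cons]
      have h₃ := filt_mono (show wordWeight w - 1 ≤ y.weight + wordWeight w - y.weight - 1 by omega)
        (hcomm rfl)
      convert add_mem h₃ h₁ using 1
      abel
    · rw [List.count_cons_of_ne hyx, List.erase_cons_tail (by simpa using hyx), word_cons,
        ← lie_nsmul, add_sub_assoc, ← lie_sub, wordWeight_cons]
      refine add_mem ?_ (letter_mem_filt y ih (by omega))
      rcases hyi.eq_or_lt with hy | hy
      · have h := hcomm hy.symm
        rw [hx y List.mem_cons_self hyx hy.symm, map_zero, sub_zero] at h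
        exact filt_mono (by omega) h
      · rw [hg, Letter.val]
        refine hB.lie_mem_filt _ _ _ _ (word_mem_filt hb le_rfl) ?_ (by omega)
        simp only [order]
        omega

end Words

section Sorting

variable {α β F : ℂ} {d : ℕ} {W : Type*} [AddCommGroup W] [Module ℂ W]
  [LieRingModule (ExtHV α β F) W] [LieModule ℂ (ExtHV α β F) W] {B : Submodule ℂ W}

local notation "𝓜" => filt (α := α) (β := β) (F := F) d

/-- Permuting the letters of a word changes it by shorter words of the same weight. -/
theorem word_sub_mem_of_perm {w w' : List Letter} (h : w.Perm w') {b : W} (hb : b ∈ B) :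
    word α β F d W w b - word α β F d W w' b ∈ Submodule.span ℂ {y | ∃ u, ∃ c ∈ B,
      u.length < w.length ∧ wordWeight u = wordWeight w ∧ y = word α β F d W u c} := by
  induction h with
  | nil => rw [sub_self]; exact zero_mem _
  | cons x _ ih =>
    rw [word_cons, word_cons, ← lie_sub]
    generalize word α β F d W _ b - word α β F d W _ b = y at ih ⊢
    induction ih using Submodule.span_induction with
    | zero => rw [lie_zero]; exact zero_mem _
    | add u v _ _ hu hv => rw [lie_add]; exact add_mem hu hv
    | smul t u _ hu => rw [lie_smul]; exact Submodule.smul_mem _ _ hu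
    | mem y hy =>
      obtain ⟨u, c, hc, hl, hw, rfl⟩ := hy
      exact Submodule.subset_span ⟨x :: u, c, hc, by simpa using hl, by simp [hw], by simp⟩
  | swap x y w =>
    obtain ⟨z, hz, hz'⟩ :=
      Letter.exists_eq (y.kind ⊔ x.kind) (m := -y.weight + -x.weight)
        (by have := x.weight_pos; have := y.weight_pos; omega)
    have hlie : ⁅y.val α β F d, x.val α β F d⁆ =
        coeff α β F d y.kind x.kind (-y.weight) (-x.weight) • z.val α β F d := by
      have := z.weight_pos
      rw [Letter.val, Letter.val, lie_gen_of_ne d _ _ (by omega), Letter.val, hz', hz, neg_neg]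
    simp only [word_cons]
    rw [leibniz_lie, add_sub_cancel_right, hlie, smul_lie]
    refine Submodule.smul_mem _ _ (Submodule.subset_span ⟨z :: w, b, hb, by simp, ?_, rfl⟩)
    simp only [wordWeight_cons]
    omega
  | trans h₁ h₂ ih₁ ih₂ =>
    rw [← h₁.length_eq, ← wordWeight_perm h₁] at ih₂
    simpa using add_mem ih₁ ih₂

variable (α β F d B) in
/-- The linear combination of sorted words with given coefficients in `B`. -/
noncomputable def formal : (Multiset Letter →₀ B) →ₗ[ℂ] W :=
  Finsupp.lsum ℂ fun e => word α β F d W e.sort ∘ₗ B.subtype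

theorem formal_apply (f : Multiset Letter →₀ B) :
    formal α β F d B f = ∑ e ∈ f.support, word α β F d W e.sort (f e) := by
  rw [formal, Finsupp.coe_lsum]
  rfl

theorem formal_single (e : Multiset Letter) (b : B) :
    formal α β F d B (Finsupp.single e b) = word α β F d W e.sort b := by
  simp [formal]

/-- Coefficient families supported on words of weight `q`. -/
def homogeneous (B : Submodule ℂ W) (q : ℤ) : Submodule ℂ (Multiset Letter →₀ B) :=
  Finsupp.supported B ℂ {e | wordWeight e.sort = q}

theorem word_mem_map_formal (w : List Letter) {b : W} (hb : b ∈ B) :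
    word α β F d W w b ∈ (homogeneous B (wordWeight w)).map (formal α β F d B) := by
  induction hn : w.length using Nat.strong_induction_on generalizing w b with
  | _ n ih =>
    have hperm : w.Perm (w : Multiset Letter).sort :=
      Multiset.coe_eq_coe.mp (Multiset.sort_eq (w : Multiset Letter) (· ≤ ·)).symm
    have h₁ := word_sub_mem_of_perm (α := α) (β := β) (F := F) (d := d) hperm hb
    have h₂ : word α β F d W (w : Multiset Letter).sort b ∈
        (homogeneous B (wordWeight w)).map (formal α β F d B) :=
      ⟨Finsupp.single (w : Multiset Letter) ⟨b, hb⟩,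
        Finsupp.single_mem_supported _ _ (wordWeight_perm hperm).symm, formal_single _ _⟩
    rw [← sub_add_cancel (word α β F d W w b)]
    refine add_mem (Submodule.span_le.mpr ?_ h₁) h₂
    rintro y ⟨u, c, hc, hl, hw, rfl⟩
    rw [← hw]
    exact ih _ (hn ▸ hl) u hc rfl

theorem exists_formal_add {q : ℤ} {y : W} (hy : y ∈ 𝓜 B q) :
    ∃ f ∈ homogeneous B q, ∃ m ∈ 𝓜 B (q - 1), formal α β F d B f + m = y := by
  suffices 𝓜 B q ≤ (homogeneous B q).map (formal α β F d B) ⊔ 𝓜 B (q - 1) by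
    obtain ⟨_, ⟨f, hf, rfl⟩, m, hm, e⟩ := Submodule.mem_sup.mp (this hy)
    exact ⟨f, hf, m, hm, e⟩
  refine Submodule.span_le.mpr ?_
  rintro y ⟨w, b, hb, hw, rfl⟩
  rcases hw.eq_or_lt with rfl | hw
  · exact Submodule.mem_sup_left (word_mem_map_formal w hb)
  · exact Submodule.mem_sup_right (word_mem_filt hb (by omega))

theorem sort_erase (e : Multiset Letter) (x : Letter) : (e.erase x).sort = e.sort.erase x := by
  refine List.Perm.eq_of_pairwise' (Multiset.pairwise_sort _ _)
    ((Multiset.pairwise_sort _ _).sublist List.erase_sublist) (Multiset.coe_eq_coe.mp ?_)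
  rw [← Multiset.coe_erase, Multiset.sort_eq, Multiset.sort_eq]

theorem wordWeight_sort_erase {e : Multiset Letter} {x : Letter} (h : x ∈ e) :
    wordWeight (e.erase x).sort = wordWeight e.sort - x.weight := by
  rw [sort_erase, wordWeight_perm (List.perm_cons_erase ((Multiset.mem_sort _).mpr h)),
    wordWeight_cons]
  omega

theorem count_sort (e : Multiset Letter) (x : Letter) : e.sort.count x = e.count x := by
  rw [← Multiset.coe_count, Multiset.sort_eq]

/-- Formal differentiation with respect to the letter `x`, followed by `H` on the coefficients. -/
noncomputable def formalDeriv (x : Letter) (H : B →ₗ[ℂ] B) (f : Multiset Letter →₀ B) :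
    Multiset Letter →₀ B :=
  f.sum fun e b => Finsupp.single (e.erase x) (e.count x • H b)

theorem formalDeriv_mem (x : Letter) (H : B →ₗ[ℂ] B) {f : Multiset Letter →₀ B} {q : ℤ}
    (hf : f ∈ homogeneous B q) : formalDeriv x H f ∈ homogeneous B (q - x.weight) := by
  refine Submodule.sum_mem _ fun e he => ?_
  by_cases hx : x ∈ e
  · refine Finsupp.single_mem_supported _ _ ?_
    have : wordWeight e.sort = q := hf he
    rw [Set.mem_ofPred_eq, wordWeight_sort_erase hx, this]
  · simp only [Multiset.count_eq_zero_of_notMem hx, zero_smul, Finsupp.single_zero]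
    exact zero_mem _

theorem formalDeriv_ne_zero {x : Letter} {H : B →ₗ[ℂ] B} (hH : ∀ b, H b = 0 → b = 0)
    {f : Multiset Letter →₀ B} {e : Multiset Letter} (he : e ∈ f.support) (hx : x ∈ e) :
    formalDeriv x H f ≠ 0 := by
  intro h
  have h' := DFunLike.congr_fun h (e.erase x)
  rw [formalDeriv, Finsupp.sum, Finsupp.finsetSum_apply, Finset.sum_eq_single e,
    Finsupp.single_eq_same, Finsupp.zero_apply, ← Nat.cast_smul_eq_nsmul ℂ] at h'
  · rcases smul_eq_zero.mp h' with h' | h'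
    · exact absurd (Nat.cast_eq_zero.mp h') (Multiset.count_pos.mpr hx).ne'
    · exact Finsupp.mem_support_iff.mp he (hH _ h')
  · intro e' _ hne
    by_cases hx' : x ∈ e'
    · refine Finsupp.single_eq_of_ne fun heq => hne ?_
      rw [← Multiset.cons_erase hx', ← Multiset.cons_erase hx, heq]
    · rw [Multiset.count_eq_zero_of_notMem hx', zero_smul, Finsupp.single_zero,
        Finsupp.zero_apply]
  · exact fun hne => absurd he hne

variable {K l : ℤ} (hB : IsBottom (α := α) (β := β) (F := F) d K l B)

include hB

/-- The leading term of the action of `gen a (threshold a + i)` on a combination of sorted words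
with letters of weight at least `i`, if only the letter `x` of weight `i` contributes. -/
theorem IsBottom.leading_term_formal (a : Fin 3) (x : Letter) (H : B →ₗ[ℂ] B)
    (hH : ∀ b, (H b : W) =
      ⁅⁅gen α β F d a (threshold K l a + x.weight), x.val α β F d⁆, (b : W)⁆)
    {f : Multiset Letter →₀ B} {q : ℤ} (hf : f ∈ homogeneous B q)
    (hi : ∀ e ∈ f.support, ∀ y ∈ e, x.weight ≤ y.weight)
    (hx : ∀ e ∈ f.support, ∀ y ∈ e, y ≠ x → y.weight = x.weight → ∀ b ∈ B,
      ⁅⁅gen α β F d a (threshold K l a + x.weight), y.val α β F d⁆, b⁆ = 0) :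
    ⁅gen α β F d a (threshold K l a + x.weight), formal α β F d B f⁆ -
      formal α β F d B (formalDeriv x H f) ∈ 𝓜 B (q - x.weight - 1) := by
  rw [formal_apply f, formalDeriv, Finsupp.sum, map_sum, lie_sum, ← Finset.sum_sub_distrib]
  refine Submodule.sum_mem _ fun e he => ?_
  have hq : wordWeight e.sort = q := hf he
  rw [formal_single, Submodule.coe_smul_of_tower, map_nsmul, hH, sort_erase, ← count_sort, ← hq]
  have h := hB.leading_term a x (f e).2 e.sort (Multiset.pairwise_sort _ _)
    (fun y hy => hi e he y ((Multiset.mem_sort _).mp hy))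
    (fun y hy h h' => hx e he y ((Multiset.mem_sort _).mp hy) h h' _ (f e).2)
  convert h using 2

end Sorting

section Core

variable {α β F : ℂ} {d : ℕ} {W : Type*} [AddCommGroup W] [Module ℂ W]
  [LieRingModule (ExtHV α β F) W] [LieModule ℂ (ExtHV α β F) W] {B : Submodule ℂ W}
  {K l : ℤ} (hB : IsBottom (α := α) (β := β) (F := F) d K l B)

local notation "𝓜" => filt (α := α) (β := β) (F := F) d

include hB

/-- Brackets of a critical generator with a letter of the complementary weight preserve `B`. -/
theorem IsBottom.lie_mem (a : Fin 3) (x : Letter) {b : W} (hb : b ∈ B) :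
    ⁅⁅gen α β F d a (threshold K l a + x.weight), x.val α β F d⁆, b⁆ ∈ B := by
  have := one_le_threshold hB.one_le hB.lt a
  rw [Letter.val, lie_gen_of_ne d _ _ (by omega), smul_lie]
  exact B.smul_mem _ (hB.gen_mem _ _ (by omega) b hb)

/-- In a non-zero homogeneous combination of sorted words, some letter of minimal weight `i` is
detected by a critical generator: `L_{-i}` by `L_{l+i}`, otherwise `J_{-i}` by `G_{K+i}`,
otherwise `G_{-i}` by `J_{K+i}`. -/
theorem IsBottom.exists_detecting (hF : F ≠ 0) {f : Multiset Letter →₀ B}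
    (hf : ∃ e ∈ f.support, ∃ x, x ∈ e) :
    ∃ (a : Fin 3) (x : Letter), (∃ e ∈ f.support, x ∈ e) ∧
      (∀ e ∈ f.support, ∀ y ∈ e, x.weight ≤ y.weight) ∧
      (∀ b ∈ B, ⁅⁅gen α β F d a (threshold K l a + x.weight), x.val α β F d⁆, b⁆ = 0 → b = 0) ∧
      (∀ e ∈ f.support, ∀ y ∈ e, y ≠ x → y.weight = x.weight → ∀ b ∈ B,
        ⁅⁅gen α β F d a (threshold K l a + x.weight), y.val α β F d⁆, b⁆ = 0) := by
  classical
  have hK := hB.one_le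
  have hl := hB.lt
  have hex : ∃ n : ℕ, ∃ e ∈ f.support, ∃ x ∈ e, x.weight = n := by
    obtain ⟨e, he, x, hx⟩ := hf
    exact ⟨x.weight.toNat, e, he, x, hx, (Int.toNat_of_nonneg (by have := x.weight_pos; omega)).symm⟩
  have hmin (e) (he : e ∈ f.support) (y) (hy : y ∈ e) : (Nat.find hex : ℤ) ≤ y.weight := by
    have h := y.weight_pos
    have := Nat.find_min' hex ⟨e, he, y, hy, (Int.toNat_of_nonneg (by omega)).symm⟩
    omega
  obtain ⟨e₀, he₀, x₀, hx₀, hw₀⟩ := Nat.find_spec hex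
  rw [← hw₀] at hmin
  have lie (a : Fin 3) (y : Letter) (hy : y.weight = x₀.weight) :
      ⁅gen α β F d a (threshold K l a + x₀.weight), y.val α β F d⁆ =
        coeff α β F d a y.kind (threshold K l a + x₀.weight) (-x₀.weight) •
          gen α β F d (a ⊔ y.kind) (threshold K l a) := by
    have := one_le_threshold hK hl a
    rw [Letter.val, lie_gen_of_ne d _ _ (by omega), hy, add_neg_cancel_right]
  have hpos := x₀.weight_pos
  by_cases h0 : ∃ e ∈ f.support, ∃ x ∈ e, x.weight = x₀.weight ∧ x.kind = 0
  · obtain ⟨e, he, x, hx, hxw, hxk⟩ := h0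
    refine ⟨0, x, ⟨e, he, hx⟩, hxw ▸ hmin, fun b hb h => ?_, fun e he y hy hyx hyw b hb => ?_⟩
    · rw [hxw, lie 0 x hxw, smul_lie, hxk] at h
      refine hB.eq_zero_of_L b hb ((smul_eq_zero.mp h).resolve_left ?_)
      simp only [coeff, threshold]
      have : l + x₀.weight - -x₀.weight ≠ 0 := by omega
      exact_mod_cast this
    · rw [hxw] at hyw ⊢
      rw [lie 0 y hyw, smul_lie, hB.gen_eq_zero _ _ _ b hb, smul_zero]
      have hk : y.kind ≠ 0 := fun hk => hyx (Letter.ext_weight_kind (hyw.trans hxw.symm)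
        (hk.trans hxk.symm))
      generalize y.kind = c at hk
      fin_cases c
      · exact absurd rfl hk
      all_goals simpa [threshold] using hl
  by_cases h1 : ∃ e ∈ f.support, ∃ x ∈ e, x.weight = x₀.weight ∧ x.kind = 1
  · obtain ⟨e, he, x, hx, hxw, hxk⟩ := h1
    refine ⟨2, x, ⟨e, he, hx⟩, hxw ▸ hmin, fun b hb h => ?_, fun e he y hy hyx hyw b hb => ?_⟩
    · rw [hxw, lie 2 x hxw, smul_lie, hxk] at h
      exact hB.eq_zero_of_G b hb ((smul_eq_zero.mp h).resolve_left (neg_ne_zero.mpr hF))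
    · rw [hxw] at hyw ⊢
      have hk0 : y.kind ≠ 0 := fun hk => h0 ⟨e, he, y, hy, hyw, hk⟩
      have hk1 : y.kind ≠ 1 := fun hk => hyx (Letter.ext_weight_kind (hyw.trans hxw.symm)
        (hk.trans hxk.symm))
      have hk : y.kind = 2 := by omega
      rw [lie 2 y hyw, hk]
      simp [coeff]
  · have hk (e) (he : e ∈ f.support) (y) (hy : y ∈ e) (hyw : y.weight = x₀.weight) :
        y.kind = 2 := by
      have hk0 : y.kind ≠ 0 := fun hk => h0 ⟨e, he, y, hy, hyw, hk⟩
      have hk1 : y.kind ≠ 1 := fun hk => h1 ⟨e, he, y, hy, hyw, hk⟩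
      omega
    have hk₀ := hk e₀ he₀ x₀ hx₀ rfl
    refine ⟨1, x₀, ⟨e₀, he₀, hx₀⟩, hmin, fun b hb h => ?_, fun e he y hy hyx hyw b hb => ?_⟩
    · rw [lie 1 x₀ rfl, smul_lie, hk₀] at h
      exact hB.eq_zero_of_G b hb ((smul_eq_zero.mp h).resolve_left hF)
    · exact absurd (Letter.ext_weight_kind hyw ((hk e he y hy hyw).trans hk₀.symm)) hyx

theorem IsBottom.exists_mem_of_formal (hF : F ≠ 0) (N : LieSubmodule ℂ (ExtHV α β F) W) (p : ℕ)
    {f : Multiset Letter →₀ B} (hf : f ∈ homogeneous B p) (hf0 : f ≠ 0) {m : W}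
    (hm : m ∈ 𝓜 B (p - 1)) (hN : formal α β F d B f + m ∈ N) : ∃ b ∈ B, b ≠ 0 ∧ b ∈ N := by
  induction p using Nat.strong_induction_on generalizing f m with
  | _ p ih =>
    obtain ⟨e, he⟩ := Finsupp.support_nonempty_iff.mpr hf0
    have hep : wordWeight e.sort = p := hf he
    by_cases hex : ∃ e ∈ f.support, ∃ x, x ∈ e
    · obtain ⟨a, x, ⟨e, he, hxe⟩, hmin, hinj, hzero⟩ := hB.exists_detecting hF hex
      have hep : wordWeight e.sort = p := hf he
      have hxp := x.weight_pos
      have hle : x.weight ≤ p := hep ▸ le_wordWeight ((Multiset.mem_sort _).mpr hxe)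
      have hta := one_le_threshold hB.one_le hB.lt a
      let H : B →ₗ[ℂ] B := (LieModule.toEnd ℂ (ExtHV α β F) W
        ⁅gen α β F d a (threshold K l a + x.weight), x.val α β F d⁆).restrict
          fun b hb => hB.lie_mem a x hb
      have hlead := hB.leading_term_formal a x H (fun b => rfl) hf hmin hzero
      have hrest : ⁅gen α β F d a (threshold K l a + x.weight), m⁆ ∈ 𝓜 B (p - x.weight - 1) :=
        hB.gen_mem_filt a _ hm (by simp only [order]; omega)
      have hcast : ((p - x.weight.toNat : ℕ) : ℤ) = p - x.weight := by omega
      refine ih (p - x.weight.toNat) (by omega) (f := formalDeriv x H f)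
        (by rw [hcast]; exact formalDeriv_mem x H hf)
        (formalDeriv_ne_zero (fun b hb => Subtype.ext (hinj b b.2 (congrArg Subtype.val hb))) he hxe)
        (by rw [hcast]; exact add_mem hlead hrest) ?_
      rw [← add_assoc, add_sub_cancel, ← lie_add]
      exact N.lie_mem hN
    · have hz : ∀ e ∈ f.support, e = 0 := fun e he =>
        Multiset.eq_zero_of_forall_notMem fun x hx => hex ⟨e, he, x, hx⟩
      obtain rfl := hz e he
      rw [Multiset.sort_zero, wordWeight_nil] at hep
      have hm0 : m = 0 := eq_zero_of_mem_filt (by omega) hm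
      have hsupp : f = Finsupp.single 0 (f 0) :=
        Finsupp.eq_single_iff.mpr ⟨fun e he => Finset.mem_singleton.mpr (hz e he), rfl⟩
      rw [hm0, add_zero, hsupp, formal_single, Multiset.sort_zero, word_nil] at hN
      exact ⟨f 0, (f 0).2, fun h => Finsupp.mem_support_iff.mp he (Subtype.ext h), hN⟩

/-- The submodule of all elements that lie in some term of the filtration. -/
def IsBottom.filtUnion : LieSubmodule ℂ (ExtHV α β F) W where
  carrier := {y | ∃ q, y ∈ 𝓜 B q}
  zero_mem' := ⟨0, zero_mem _⟩
  add_mem' := fun ⟨q, hq⟩ ⟨r, hr⟩ => ⟨max q r, add_mem (filt_mono (le_max_left q r) hq)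
    (filt_mono (le_max_right q r) hr)⟩
  smul_mem' := fun t _ ⟨q, hq⟩ => ⟨q, Submodule.smul_mem _ t hq⟩
  lie_mem := by
    rintro x y ⟨q, hq⟩
    induction (basis α β F).mem_span x using Submodule.span_induction with
    | zero => exact ⟨0, by rw [zero_lie]; exact zero_mem _⟩
    | add u v _ _ hu hv =>
      obtain ⟨r, hr⟩ := hu
      obtain ⟨s, hs⟩ := hv
      exact ⟨max r s, by
        rw [add_lie]
        exact add_mem (filt_mono (le_max_left r s) hr) (filt_mono (le_max_right r s) hs)⟩
    | smul t u _ hu =>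
      obtain ⟨r, hr⟩ := hu
      exact ⟨r, by rw [smul_lie]; exact Submodule.smul_mem _ _ hr⟩
    | mem u hu =>
      obtain ⟨c, rfl⟩ := hu
      rcases basis_mem (α := α) (β := β) (F := F) d c with hc | ⟨a, m, hc⟩
      · exact ⟨q, hB.centre_mem_filt hc hq⟩
      · rw [hc]
        exact ⟨_, hB.gen_mem_filt a m hq le_rfl⟩

/-- Every non-zero submodule meets `B`, if `B` generates the module. -/
theorem IsBottom.exists_mem (hF : F ≠ 0)
    (hgen : ∀ N : LieSubmodule ℂ (ExtHV α β F) W, (∀ b ∈ B, b ∈ N) → N = ⊤)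
    (N : LieSubmodule ℂ (ExtHV α β F) W) (hN : N ≠ ⊥) : ∃ b ∈ B, b ≠ 0 ∧ b ∈ N := by
  classical
  obtain ⟨y, hy, hy0⟩ : ∃ y ∈ N, y ≠ 0 := by
    by_contra! h
    exact hN ((LieSubmodule.eq_bot_iff N).mpr h)
  have hfilt : ∃ p : ℕ, y ∈ 𝓜 B p := by
    have htop := hgen hB.filtUnion fun b hb => ⟨0, word_mem_filt (w := []) hb le_rfl⟩
    obtain ⟨q, hq⟩ : y ∈ hB.filtUnion := htop ▸ LieSubmodule.mem_top y
    exact ⟨q.toNat, filt_mono (Int.self_le_toNat q) hq⟩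
  obtain ⟨f, hf, m, hm, e⟩ := exists_formal_add (Nat.find_spec hfilt)
  refine hB.exists_mem_of_formal hF N _ hf ?_ hm (e ▸ hy)
  rintro rfl
  rw [map_zero, zero_add] at e
  subst e
  rcases Nat.eq_zero_or_pos (Nat.find hfilt) with h | h
  · exact hy0 (eq_zero_of_mem_filt (by omega) hm)
  · refine Nat.find_min hfilt (m := Nat.find hfilt - 1) (by omega) ?_
    rwa [Nat.cast_sub h, Nat.cast_one]

end Core

section Complement

variable (α β F : ℂ) (d : ℕ)

/-- The subalgebra spanned by the generators of negative index, a complement of `𝓛_d`. -/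
noncomputable def neg : LieSubalgebra ℂ (ExtHV α β F) where
  __ := Submodule.span ℂ {x | ∃ a m, m < 0 ∧ x = gen α β F d a m}
  lie_mem' {x y} hx hy := by
    change ⁅x, y⁆ ∈ Submodule.span ℂ {x | ∃ a m, m < 0 ∧ x = gen α β F d a m}
    induction hx using Submodule.span_induction with
    | zero => rw [zero_lie]; exact zero_mem _
    | add u v _ _ hu hv => rw [add_lie]; exact add_mem hu hv
    | smul t u _ hu => rw [smul_lie]; exact Submodule.smul_mem _ t hu
    | mem x hx =>
      induction hy using Submodule.span_induction with
      | zero => rw [lie_zero]; exact zero_mem _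
      | add u v _ _ hu hv => rw [lie_add]; exact add_mem hu hv
      | smul t u _ hu => rw [lie_smul]; exact Submodule.smul_mem _ t hu
      | mem y hy =>
        obtain ⟨a, m, hm, rfl⟩ := hx
        obtain ⟨b, n, hn, rfl⟩ := hy
        rw [lie_gen_of_ne d a b (by omega)]
        exact Submodule.smul_mem _ _ (Submodule.subset_span ⟨_, _, by omega, rfl⟩)

variable {α β F}

theorem gen_mem_sub (a : Fin 3) {m : ℤ} (hm : 0 ≤ m) : gen α β F d a m ∈ sub α β F d := by
  refine Submodule.subset_span ?_
  lift m to ℕ using hm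
  fin_cases a
  · exact .inl ⟨m, rfl⟩
  · exact .inr (.inl ⟨m, rfl⟩)
  · exact .inr (.inr (.inl ⟨m, by simp only [gen]; congr 1; ring⟩))

theorem mem_sub_of_mem_centre {z : ExtHV α β F} (hz : z ∈ centre α β F) : z ∈ sub α β F d := by
  refine Submodule.span_mono ?_ hz
  rintro x (rfl | rfl | rfl) <;> simp [posGens]

theorem isCompl_neg_sub : IsCompl (neg α β F d).toSubmodule (sub α β F d).toSubmodule := by
  constructor
  · let S : Set Gen := fun c => match c with
      | .L m => m < 0
      | .J m => m < 0
      | .G m => m < -d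
      | _ => False
    refine ((basis α β F).linearIndependent.disjoint_span_image
      (disjoint_compl_right (a := S))).mono (Submodule.span_mono ?_) (Submodule.span_mono ?_)
    · rintro x ⟨a, m, hm, rfl⟩
      fin_cases a
      · exact ⟨.L m, hm, rfl⟩
      · exact ⟨.J m, hm, rfl⟩
      · exact ⟨.G (m - d), show m - d < -(d : ℤ) by omega, rfl⟩
    · rintro x (⟨i, rfl⟩ | ⟨i, rfl⟩ | ⟨i, rfl⟩ | rfl | rfl | rfl)
      · exact ⟨.L i, show ¬ ((i : ℤ) < 0) by omega, rfl⟩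
      · exact ⟨.J i, show ¬ ((i : ℤ) < 0) by omega, rfl⟩
      · exact ⟨.G (-d + i), show ¬ (-(d : ℤ) + i < -d) by omega, rfl⟩
      · exact ⟨.C₁, not_false, rfl⟩
      · exact ⟨.C₂, not_false, rfl⟩
      · exact ⟨.C₃, not_false, rfl⟩
  · rw [codisjoint_iff_le_sup, ← (basis α β F).span_eq, Submodule.span_le]
    rintro _ ⟨c, rfl⟩
    rcases basis_mem (α := α) (β := β) (F := F) d c with hc | ⟨a, m, hc⟩
    · exact Submodule.mem_sup_right (mem_sub_of_mem_centre d hc)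
    · rw [hc]
      rcases lt_or_ge m 0 with hm | hm
      · exact Submodule.mem_sup_left (Submodule.subset_span ⟨a, m, hm, rfl⟩)
      · exact Submodule.mem_sup_right (gen_mem_sub d a hm)

end Complement

/-- The image of `V` in the induced module has the properties that the proof needs. -/
theorem isBottom_range_incl (α β F : ℂ) (d : ℕ)
    (V : Type*) [AddCommGroup V] [Module ℂ V]
    [LieRingModule (ExtHV.sub α β F d) V] [LieModule ℂ (ExtHV.sub α β F d) V]
    (k l : ℕ) (hkd : 0 < k + d) (hl : k + d < l)
    (hGinj : Function.Injective fun v : V => ⁅ExtHV.subG α β F d k, v⁆)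
    (hLinj : Function.Injective fun v : V => ⁅ExtHV.subL α β F d l, v⁆)
    (hG : ∀ i : ℕ, 1 ≤ i → ∀ v : V, ⁅ExtHV.subG α β F d (k + i), v⁆ = 0)
    (hJ : ∀ i : ℕ, 1 ≤ i → ∀ v : V, ⁅ExtHV.subJ α β F d (k + d + i), v⁆ = 0)
    (hL : ∀ i : ℕ, 1 ≤ i → ∀ v : V, ⁅ExtHV.subL α β F d (l + i), v⁆ = 0) :
    IsBottom (α := α) (β := β) (F := F) d (k + d) l
      (LinearMap.range (LieInduction.incl ℂ (sub α β F d) V)) where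
  one_le := by omega
  lt := by omega
  gen_mem := by
    rintro a m hm _ ⟨v, rfl⟩
    exact ⟨_, (LieInduction.lie_incl V (⟨_, gen_mem_sub d a hm⟩ : sub α β F d) v).symm⟩
  centre_mem := by
    rintro z hz _ ⟨v, rfl⟩
    exact ⟨_, (LieInduction.lie_incl V (⟨z, mem_sub_of_mem_centre d hz⟩ : sub α β F d) v).symm⟩
  gen_eq_zero := by
    rintro a m hm _ ⟨v, rfl⟩
    fin_cases a
    · have hm : (l : ℤ) < m := hm
      obtain ⟨i, hi, rfl⟩ : ∃ i : ℕ, 1 ≤ i ∧ m = (l + i : ℕ) := ⟨(m - l).toNat, by omega, by omega⟩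
      exact (LieInduction.lie_incl V (subL α β F d (l + i)) v).trans (by rw [hL i hi, map_zero])
    · have hm : (k + d : ℤ) < m := hm
      obtain ⟨i, hi, rfl⟩ : ∃ i : ℕ, 1 ≤ i ∧ m = (k + d + i : ℕ) :=
        ⟨(m - (k + d)).toNat, by omega, by omega⟩
      exact (LieInduction.lie_incl V (subJ α β F d (k + d + i)) v).trans
        (by rw [hJ i hi, map_zero])
    · have hm : (k + d : ℤ) < m := hm
      obtain ⟨i, hi, rfl⟩ : ∃ i : ℕ, 1 ≤ i ∧ m = (k + i : ℕ) + d :=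
        ⟨(m - (k + d)).toNat, by omega, by omega⟩
      have e : gen α β F d 2 ((k + i : ℕ) + d) = subG α β F d (k + i) :=
        congrArg (G α β F) (add_sub_cancel_right _ _)
      exact (congrArg (fun x => ⁅x, LieInduction.incl ℂ (sub α β F d) V v⁆) e).trans
        ((LieInduction.lie_incl V (subG α β F d (k + i)) v).trans (by rw [hG i hi, map_zero]))
  eq_zero_of_L := by
    rintro _ ⟨v, rfl⟩ h
    have h' := (LieInduction.lie_incl V (subL α β F d l) v).symm.trans h
    rw [map_eq_zero_iff _ (LieInduction.incl_injective V (isCompl_neg_sub d))] at h'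
    rw [hLinj (h'.trans (lie_zero _).symm), map_zero]
  eq_zero_of_G := by
    rintro _ ⟨v, rfl⟩ h
    have e : gen α β F d 2 (k + d) = subG α β F d k :=
      congrArg (G α β F) (add_sub_cancel_right _ _)
    rw [e] at h
    have h' := (LieInduction.lie_incl V (subG α β F d k) v).symm.trans h
    rw [map_eq_zero_iff _ (LieInduction.incl_injective V (isCompl_neg_sub d))] at h'
    rw [hGinj (h'.trans (lie_zero _).symm), map_zero]

end ExtHV

theorem mainTheorem3 (α β F : ℂ) (hF : F ≠ 0) (d : ℕ)
    (V : Type*) [AddCommGroup V] [Module ℂ V]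
    [LieRingModule (ExtHV.sub α β F d) V] [LieModule ℂ (ExtHV.sub α β F d) V]
    (hV : LieModule.IsIrreducible ℂ (ExtHV.sub α β F d) V)
    (k l : ℕ) (hkd : 0 < k + d) (hl : k + d < l)
    (hGinj : Function.Injective fun v : V => ⁅ExtHV.subG α β F d k, v⁆)
    (hLinj : Function.Injective fun v : V => ⁅ExtHV.subL α β F d l, v⁆)
    (hG : ∀ i : ℕ, 1 ≤ i → ∀ v : V, ⁅ExtHV.subG α β F d (k + i), v⁆ = 0)
    (hJ : ∀ i : ℕ, 1 ≤ i → ∀ v : V, ⁅ExtHV.subJ α β F d (k + d + i), v⁆ = 0)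
    (hL : ∀ i : ℕ, 1 ≤ i → ∀ v : V, ⁅ExtHV.subL α β F d (l + i), v⁆ = 0) :
    LieModule.IsIrreducible ℂ (ExtHV α β F)
      (LieInduction.Ind ℂ (ExtHV.sub α β F d) V) := by
  have hB := ExtHV.isBottom_range_incl α β F d V k l hkd hl hGinj hLinj hG hJ hL
  have hinj := LieInduction.incl_injective V (ExtHV.isCompl_neg_sub (α := α) (β := β) (F := F) d)
  have : Nontrivial V :=
    (LieSubmodule.nontrivial_iff ℂ (ExtHV.sub α β F d) V).mp hV.toNontrivial
  have : Nontrivial (LieInduction.Ind ℂ (ExtHV.sub α β F d) V) := hinj.nontrivial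
  refine LieModule.IsIrreducible.mk fun N hN => ?_
  obtain ⟨_, ⟨v, rfl⟩, hv0, hvN⟩ := hB.exists_mem hF
    (fun N hN => LieInduction.eq_top_of_incl_mem V N fun v => hN _ ⟨v, rfl⟩) N hN
  let N' : LieSubmodule ℂ (ExtHV.sub α β F d) V :=
    { N.toSubmodule.comap (LieInduction.incl ℂ (ExtHV.sub α β F d) V) with
      lie_mem := fun {x w} hw => by
        change LieInduction.incl ℂ (ExtHV.sub α β F d) V ⁅x, w⁆ ∈ N
        rw [← LieInduction.lie_incl]
        exact N.lie_mem hw }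
  have hN' : N' = ⊤ := (hV.eq_bot_or_eq_top N').resolve_left fun h => by
    have hv : v ∈ N' := hvN
    rw [h, LieSubmodule.mem_bot] at hv
    exact hv0 (by rw [hv, map_zero])
  refine LieInduction.eq_top_of_incl_mem V N fun w => ?_
  have hw : w ∈ N' := hN' ▸ LieSubmodule.mem_top w
  exact hw
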